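/- Let $\eta=(\eta(t))_{t\in\mathbb Z}$ be a stationary simple max-stable process: all shifts $\eta(\cdot+s)$, $s\in\mathbb Z$, have the law of $\eta$; $\mathbb P[\eta(t)\le y]=e^{-1/y}$ for all $t\in\mathbb Z$ and $y>0$; and for every $n\ge 1$, $n^{-1}\bigvee_{i=1}^n\eta_i$ has the law of $\eta$ when $\eta_1,\dots,\eta_n$ are independent copies of $\eta$. Let $Y=(Y(t))_{t\in\mathbb Z}$ be a spectral process of $\eta$, that is, a nonnegative process with $\mathbb E[Y(t)]=1$ for all $t\in\mathbb Z$ such that $$\big(\eta(t)\big)_{t\in\mathbb Z}\overset{d}{=}\Big(\bigvee_{i\ge 1}U_iY_i(t)\Big)_{t\in\mathbb Z},$$ where $(Y_i)_{i\ge1}$ are i.i.d. copies of $Y$ and $(U_i)_{i\ge 1}$, independent of $(Y_i)_{i\ge1}$, are the points of a Poisson point process on $(0,\infty)$ with intensity $u^{-2}\,du$. Let $a\in[0,1]$, let $(F_n)_{n\in\mathbb Z}$ be i.i.d. random variables with $\mathbb P[F_n\le y]=e^{-1/y}$ for all $y>0$, and let $X_a$ be the max-AR(1) process $$X_a(t)=\bigvee_{n\le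 t}(1-a)\,a^{t-n}F_n\quad (0\le a<1),\qquad X_1(t)=F_0,\qquad t\in\mathbb Z,$$ with the convention $0^0=1$. Define the following cones of functions $f:\mathbb Z\to[0,\infty)$: $$D_1=\{f:\ \forall t,\ f(t)=f(0)\},\qquad D_0=\{f:\ \exists t_0\in\mathbb Z\ \forall t,\ f(t)=f(t_0)1_{\{t=t_0\}}\},$$ $$D_a=\{f:\ \exists t_0\in\mathbb Z\ \forall t,\ f(t)=f(t_0)a^{t-t_0}1_{\{t\ge t_0\}}\}\quad(0<a<1).$$ Then $\eta$ has the same distribution as $X_a$ if and only if $\mathbb P[Y\in D_a]=1$. -/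

import Mathlib

open MeasureTheory ProbabilityTheory

namespace MaxStable

/-- `X` has the standard `1`-Fréchet distribution: `ℙ[X ≤ y] = exp(-1/y)` for all `y > 0`
(hence `X > 0` almost surely). -/
def HasFrechetLaw {Ω : Type*} [MeasurableSpace Ω] (X : Ω → ℝ) (P : Measure Ω) : Prop :=
  AEMeasurable X P ∧ ∀ y : ℝ, 0 < y → P {ω | X ω ≤ y} = ENNReal.ofReal (Real.exp (-1 / y))

/-- A simple max-stable process on `ℤ`: `1`-Fréchet marginals, and for all `n ≥ 1` the rescaled
pointwise maximum of `n` independent copies of `η` has the law of `η`. The independent copies are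
realized on the product space `Ωⁿ`, the `i`-th copy being `ω ↦ η (ω i)`. -/
structure IsSimpleMaxStable {Ω : Type*} [MeasurableSpace Ω] (η : Ω → ℤ → ℝ) (P : Measure Ω)
    [IsProbabilityMeasure P] : Prop where
  measurable : Measurable η
  frechet : ∀ t : ℤ, HasFrechetLaw (fun ω => η ω t) P
  maxStable : ∀ n : ℕ, 1 ≤ n →
    IdentDistrib (fun (ω : Fin n → Ω) (t : ℤ) => (n : ℝ)⁻¹ * ⨆ i : Fin n, η (ω i) t) η
      (Measure.pi fun _ : Fin n => P) P

/-- Stationarity: all the shifted processes `η(· + s)` have the law of `η`. -/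
def IsStationary {Ω : Type*} [MeasurableSpace Ω] (η : Ω → ℤ → ℝ) (P : Measure Ω) : Prop :=
  ∀ s : ℤ, IdentDistrib (fun (ω : Ω) (t : ℤ) => η ω (t + s)) η P P

/-- The point measure `∑ i, δ_{U i ω}` of a sequence of random points. -/
noncomputable def pointMeasure {Ω : Type*} (U : ℕ → Ω → ℝ) (ω : Ω) : Measure ℝ :=
  Measure.sum fun i => Measure.dirac (U i ω)

/-- The points `U i` form a Poisson point process with intensity measure `Λ`: the number of points
in a measurable set `B` is Poisson distributed with mean `Λ B` (almost surely infinite when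
`Λ B = ∞`), and the numbers of points in pairwise disjoint measurable sets are independent. -/
structure IsPoissonPointProcess {Ω : Type*} [MeasurableSpace Ω] (U : ℕ → Ω → ℝ) (Λ : Measure ℝ)
    (P : Measure Ω) : Prop where
  measurable : ∀ i, Measurable (U i)
  poisson : ∀ B : Set ℝ, MeasurableSet B → Λ B ≠ ⊤ → ∀ k : ℕ,
    P {ω | pointMeasure U ω B = k} =
      ENNReal.ofReal (Real.exp (-(Λ B).toReal) * (Λ B).toReal ^ k / (Nat.factorial k : ℝ))
  infinite : ∀ B : Set ℝ, MeasurableSet B → Λ B = ⊤ → ∀ᵐ ω ∂P, pointMeasure U ω B = ⊤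
  indep : ∀ (m : ℕ) (B : Fin m → Set ℝ), (∀ j, MeasurableSet (B j)) →
    Pairwise (fun j k => Disjoint (B j) (B k)) →
    iIndepFun (fun (j : Fin m) (ω : Ω) => pointMeasure U ω (B j)) P

/-- The measure `u⁻² du` on `(0, ∞)`. -/
noncomputable def inverseSquareMeasure : Measure ℝ :=
  (volume.restrict (Set.Ioi (0 : ℝ))).withDensity fun u => ENNReal.ofReal ((u ^ 2)⁻¹)

/-- `Y` is a spectral process of `η`, as witnessed by the points `U i` and the copies `Y' i`:
`Y` is nonnegative with `𝔼[Y(t)] = 1` for all `t`, the `Y' i` are i.i.d. copies of `Y`, the `U i`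
are the points of a Poisson point process on `(0, ∞)` with intensity `u⁻² du`, independent of the
`Y' i`, and `η` has the law of `⋁ i, U i * Y' i`. The supremum is taken in `[-∞, ∞]`, so that it
is always the true supremum. -/
structure IsDeHaanRepresentation {Ω Ω' S : Type*} [MeasurableSpace Ω] [MeasurableSpace Ω']
    [MeasurableSpace S] (η : Ω → ℤ → ℝ) (P : Measure Ω) (Y : Ω' → ℤ → ℝ) (Q : Measure Ω')
    (U : ℕ → S → ℝ) (Y' : ℕ → S → ℤ → ℝ) (R : Measure S) : Prop where
  measurable : Measurable Y
  nonneg : ∀ᵐ ω ∂Q, ∀ t : ℤ, 0 ≤ Y ω t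
  integrable : ∀ t : ℤ, Integrable (fun ω => Y ω t) Q
  integral_eq_one : ∀ t : ℤ, ∫ ω, Y ω t ∂Q = 1
  copies : ∀ i, IdentDistrib (Y' i) Y R Q
  copies_indep : iIndepFun Y' R
  poisson : IsPoissonPointProcess U inverseSquareMeasure R
  indep : IndepFun (fun (ω : S) (i : ℕ) => U i ω) (fun (ω : S) (i : ℕ) => Y' i ω) R
  representation : IdentDistrib (fun (ω : Ω) (t : ℤ) => ((η ω t : ℝ) : EReal))
    (fun (ω : S) (t : ℤ) => ⨆ i : ℕ, ((U i ω * Y' i ω t : ℝ) : EReal)) P R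

/-- The max-AR(1) process with parameter `a ∈ [0, 1]` driven by `(F n)`:
`X_a(t) = ⋁_{n ≤ t} (1 - a) a^{t-n} F n` for `a < 1`, and `X_1(t) = F 0`. The supremum is taken in
`[-∞, ∞]`, so that it is always the true supremum; it is almost surely finite when the `F n` are
i.i.d. standard `1`-Fréchet. -/
noncomputable def maxAR {Ω : Type*} (a : ℝ) (F : ℤ → Ω → ℝ) (ω : Ω) (t : ℤ) : EReal :=
  open Classical in
  if a = 1 then ((F 0 ω : ℝ) : EReal)
  else ⨆ n : ℤ, ⨆ _ : n ≤ t, (((1 - a) * a ^ (t - n) * F n ω : ℝ) : EReal)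

/-- The cone `D_a` of nonnegative functions on `ℤ`: constant functions for `a = 1`, multiples of
Dirac functions for `a = 0`, and functions `f(t₀) a^{t-t₀} 1_{t ≥ t₀}` for `0 < a < 1`. -/
def coneD (a : ℝ) : Set (ℤ → ℝ) :=
  open Classical in
  {f | (∀ t, 0 ≤ f t) ∧
    if a = 1 then ∀ t, f t = f 0
    else if a = 0 then ∃ t₀ : ℤ, ∀ t, f t = if t = t₀ then f t₀ else 0
    else ∃ t₀ : ℤ, ∀ t, f t = if t₀ ≤ t then f t₀ * a ^ (t - t₀) else 0}

end MaxStable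

/-!
The laws of both processes are determined by the probabilities of the windows
`{w j * x (s + j) ≤ 1, 0 ≤ j ≤ k}` with weights `w j ≥ 0` (`ext_of_window`), and both probabilities
are exponentials.

For the max-stable process with spectral process `Y`, the exponent is `-𝔼[max_j w j * Y (s + j)]`
(`IsDeHaanRepresentation.measure_window`). Indeed, the window event says that no point `U i` times
its mark `max_j w j * Y' i (s + j)` exceeds `1`. Conditioning on the points and using the generating
functional `𝔼[∏ i, (1 - h (U i))] = exp(-∫ h dΛ)` of the Poisson process (`lintegral_voidProd`), the
probability is `exp(-∫ ℙ[u Z > 1] u⁻² du) = exp(-𝔼 Z)`, where `Z` has the law of the marks.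

For the max-AR(1) process, the recursion `X(t + 1) = max (a X(t)) ((1 - a) F (t + 1))` allows one to
remove the last time of the window: this gives the exponent `-arExponent a k w`
(`measure_maxAR_window`), which solves
`Ψ (w 0, …, w (k + 1)) = Ψ (w 0, …, max (w k) (a * w (k + 1))) + (1 - a) * w (k + 1)`.

Hence the two laws agree if and only if `𝔼[max_j w j * Y (s + j)] = arExponent a k w` for all
windows. If `Y` lies in the cone `D_a`, then at each step either `Y (t + 1) = a * Y t` or `Y`
vanishes up to time `t`, so that the maxima satisfy the same recursion pathwise up to the term
`w (k + 1) * (Y (t + 1) - a * Y t)`, whose mean is `(1 - a) * w (k + 1)`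
(`integral_windowMax_of_mem_coneD`). Conversely, special weights turn the identity of means into
almost sure identities. Weights `(a, 1)` give `a * Y s ≤ Y (s + 1)`, which for `a = 1` is an equality
since the means agree. For `0 < a < 1`, weights `(a + 1, 1)` give `Y (s + 1) = a * Y s` or
`Y s = 0`, and since `a ^ k * Y (-k)` has the summable means `a ^ k`, the path cannot be `c * a ^ t`
on all of `ℤ`. For `a = 0`, unit weights show that the maximum over any window equals the sum, so
that at most one value is nonzero (`ae_mem_coneD_of_integral_windowMax`).
-/

namespace MaxStable

open scoped ENNReal
open Filter Topology

/-! ### The generating functional of a Poisson point process -/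

/-- The function `k ↦ q ^ k` on the finite natural numbers inside `[0, ∞]`, extended by zero: it
turns the `[0, ∞]`-valued number of points in a set into a factor of a generating functional. -/
noncomputable def powCount (q x : ℝ≥0∞) : ℝ≥0∞ :=
  ∑' k : ℕ, ({(k : ℝ≥0∞)} : Set ℝ≥0∞).indicator (fun _ => q ^ k) x

lemma measurable_powCount (q : ℝ≥0∞) : Measurable (powCount q) :=
  Measurable.tsum fun _ => measurable_const.indicator (measurableSet_singleton _)

lemma powCount_natCast (q : ℝ≥0∞) (k : ℕ) : powCount q k = q ^ k := by
  unfold powCount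
  rw [tsum_eq_single k]
  · simp
  · intro j hj
    simp [Ne.symm hj]

lemma hasSum_poisson_pow (l p : ℝ) :
    HasSum (fun k : ℕ => p ^ k * (Real.exp (-l) * l ^ k / (Nat.factorial k : ℝ)))
      (Real.exp (-(l * (1 - p)))) := by
  have h := (NormedSpace.expSeries_div_hasSum_exp (l * p)).mul_left (Real.exp (-l))
  rw [← Real.exp_eq_exp_ℝ, ← Real.exp_add] at h
  rw [show -(l * (1 - p)) = -l + l * p by ring]
  refine h.congr_fun ?_
  intro k
  rw [mul_pow]
  ring

lemma tsum_poisson_pow {S : Type*} [MeasurableSpace S] {μ : Measure S} {N : S → ℝ≥0∞} {l : ℝ}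
    (hl : 0 ≤ l) (h : ∀ k : ℕ, μ {ω | N ω = k} =
      ENNReal.ofReal (Real.exp (-l) * l ^ k / (Nat.factorial k : ℝ)))
    {q : ℝ≥0∞} (hq : q ≠ ∞) :
    ∑' k : ℕ, q ^ k * μ {ω | N ω = k} = ENNReal.ofReal (Real.exp (-(l * (1 - q.toReal)))) := by
  rw [← (hasSum_poisson_pow l q.toReal).tsum_eq,
    ENNReal.ofReal_tsum_of_nonneg (fun k => by positivity) (hasSum_poisson_pow l q.toReal).summable]
  congr 1 with k
  rw [h k, ENNReal.ofReal_mul (by positivity), ENNReal.ofReal_pow (by positivity),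
    ENNReal.ofReal_toReal hq]

lemma lintegral_powCount_poisson {S : Type*} [MeasurableSpace S] {μ : Measure S} {N : S → ℝ≥0∞}
    (hN : Measurable N) {l : ℝ}
    (hl : 0 ≤ l) (h : ∀ k : ℕ, μ {ω | N ω = k} =
      ENNReal.ofReal (Real.exp (-l) * l ^ k / (Nat.factorial k : ℝ)))
    {q : ℝ≥0∞} (hq : q ≠ ∞) :
    ∫⁻ ω, powCount q (N ω) ∂μ = ENNReal.ofReal (Real.exp (-(l * (1 - q.toReal)))) := by
  rw [← tsum_poisson_pow hl h hq]
  unfold powCount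
  rw [lintegral_tsum]
  · congr 1 with k
    have : (fun ω => ({(k : ℝ≥0∞)} : Set ℝ≥0∞).indicator (fun _ => q ^ k) (N ω)) =
        (N ⁻¹' {(k : ℝ≥0∞)}).indicator (fun _ => q ^ k) := rfl
    rw [this, lintegral_indicator (hN (measurableSet_singleton _))]
    simp
    rfl
  · intro k
    exact ((measurable_const.indicator (measurableSet_singleton _)).comp hN).aemeasurable

/-- A `[0, ∞]`-valued variable with a Poisson law is almost surely a natural number. -/
lemma ae_ne_top_of_poisson {S : Type*} [MeasurableSpace S] {μ : Measure S}
    [IsProbabilityMeasure μ] {N : S → ℝ≥0∞} (hN : Measurable N) {l : ℝ}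
    (hl : 0 ≤ l) (h : ∀ k : ℕ, μ {ω | N ω = k} =
      ENNReal.ofReal (Real.exp (-l) * l ^ k / (Nat.factorial k : ℝ))) :
    ∀ᵐ ω ∂μ, N ω ≠ ∞ := by
  have hm : ∀ k : ℕ, MeasurableSet {ω | N ω = k} := fun k => hN (measurableSet_singleton _)
  have h1 : μ (⋃ k : ℕ, {ω | N ω = k}) = 1 := by
    rw [measure_iUnion _ hm]
    · simpa using tsum_poisson_pow hl h (q := 1) (by simp)
    · intro i j hij
      refine Set.disjoint_left.2 fun ω hi hj => hij ?_
      have : (i : ℝ≥0∞) = j := by rw [← hi, ← hj]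
      exact_mod_cast this
  have h2 := (prob_compl_eq_zero_iff (MeasurableSet.iUnion hm)).2 h1
  refine measure_mono_null ?_ h2
  intro ω hω
  simp only [ne_eq, Set.mem_compl_iff, not_not, Set.mem_ofPred_eq] at hω
  simp [hω]

lemma pointMeasure_apply {S : Type*} (U : ℕ → S → ℝ) (ω : S) {B : Set ℝ}
    (hB : MeasurableSet B) : pointMeasure U ω B = ∑' i, B.indicator 1 (U i ω) := by
  rw [pointMeasure, Measure.sum_apply _ hB]
  simp [Measure.dirac_apply' _ hB]

lemma pointMeasure_apply_eq_encard {S : Type*} (U : ℕ → S → ℝ) (ω : S) {B : Set ℝ}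
    (hB : MeasurableSet B) : pointMeasure U ω B = ({i | U i ω ∈ B} : Set ℕ).encard := by
  rw [pointMeasure_apply U ω hB, ← ENNReal.tsum_set_one,
    tsum_subtype {i | U i ω ∈ B} (fun _ => (1 : ℝ≥0∞))]
  rfl

lemma measurable_pointMeasure_apply {S : Type*} [MeasurableSpace S] {U : ℕ → S → ℝ}
    (hU : ∀ i, Measurable (U i)) {B : Set ℝ} (hB : MeasurableSet B) :
    Measurable fun ω => pointMeasure U ω B := by
  simp_rw [pointMeasure_apply U _ hB]
  exact Measurable.tsum fun i => (measurable_one.indicator hB).comp (hU i)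

/-- The product of the numbers `1 - h (u i)` over all `i`, as the infimum of its finite partial
products (which lie in `[0, 1]`). -/
noncomputable def voidProd (h : ℝ → ℝ≥0∞) (u : ℕ → ℝ) : ℝ≥0∞ :=
  ⨅ I : Finset ℕ, ∏ i ∈ I, (1 - h (u i))

lemma voidProd_le_one (h : ℝ → ℝ≥0∞) (u : ℕ → ℝ) : voidProd h u ≤ 1 :=
  iInf_le_of_le ∅ (by simp)

lemma measurable_voidProd {h : ℝ → ℝ≥0∞} (hh : Measurable h) : Measurable (voidProd h) := by
  refine Measurable.iInf fun I => Finset.measurable_prod I fun i _ => ?_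
  exact measurable_const.sub (hh.comp (measurable_pi_apply i))

lemma voidProd_eq_prod {h : ℝ → ℝ≥0∞} {u : ℕ → ℝ} {J : Finset ℕ} (hJ : ∀ i ∉ J, h (u i) = 0) :
    voidProd h u = ∏ i ∈ J, (1 - h (u i)) := by
  refine le_antisymm (iInf_le _ J) (le_iInf fun I => ?_)
  calc ∏ i ∈ J, (1 - h (u i)) ≤ ∏ i ∈ J ∩ I, (1 - h (u i)) :=
        Finset.prod_le_prod_of_subset_of_le_one' Finset.inter_subset_left
          fun _ _ _ => tsub_le_self
    _ = ∏ i ∈ I, (1 - h (u i)) := by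
        refine Finset.prod_subset Finset.inter_subset_right fun i hi hi' => ?_
        have : i ∉ J := fun hj => hi' (Finset.mem_inter.2 ⟨hj, hi⟩)
        simp [hJ i this]

/-- For a simple function, the product over all points only depends on the numbers of points in
its level sets. -/
lemma voidProd_simpleFunc_eq {S : Type*} (U : ℕ → S → ℝ) (ω : S) (h : SimpleFunc ℝ ℝ≥0∞)
    (hfin : ∀ c ∈ h.range.filter (· ≠ 0), pointMeasure U ω (h ⁻¹' {c}) ≠ ∞) :
    voidProd h (fun i => U i ω) =
      ∏ c ∈ h.range.filter (· ≠ 0), powCount (1 - c) (pointMeasure U ω (h ⁻¹' {c})) := by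
  have hf : ∀ c ∈ h.range.filter (· ≠ 0), ({i | U i ω ∈ h ⁻¹' {c}} : Set ℕ).Finite := by
    intro c hc
    have := hfin c hc
    rw [pointMeasure_apply_eq_encard U ω (h.measurableSet_fiber c)] at this
    rw [← Set.encard_ne_top_iff]
    intro h'
    rw [h'] at this
    simp at this
  have hJ : ({i | h (U i ω) ≠ 0} : Set ℕ).Finite := by
    refine ((h.range.filter (· ≠ 0)).finite_toSet.biUnion hf).subset fun i hi => ?_
    simp only [Set.mem_iUnion]
    exact ⟨h (U i ω), by simpa using hi, rfl⟩
  rw [voidProd_eq_prod (J := hJ.toFinset) (by simp)]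
  have key : ∀ i ∈ hJ.toFinset, h (U i ω) ∈ h.range.filter (· ≠ 0) := by
    intro i hi
    simpa using hi
  rw [← Finset.prod_fiberwise_of_maps_to key]
  refine Finset.prod_congr rfl fun c hc => ?_
  have hc0 : c ≠ 0 := (Finset.mem_filter.1 hc).2
  rw [pointMeasure_apply_eq_encard U ω (h.measurableSet_fiber c)]
  have hset : ({i | U i ω ∈ h ⁻¹' {c}} : Set ℕ) =
      ((hJ.toFinset.filter fun i => h (U i ω) = c : Finset ℕ) : Set ℕ) := by
    ext i
    simp only [Set.mem_preimage, Set.mem_singleton_iff, Set.mem_ofPred_eq, Finset.coe_filter,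
      Set.Finite.mem_toFinset]
    constructor
    · intro h'
      exact ⟨by rw [h']; exact hc0, h'⟩
    · exact fun h' => h'.2
  rw [hset, Set.encard_coe_eq_coe_finsetCard]
  have := powCount_natCast (1 - c) (hJ.toFinset.filter fun i => h (U i ω) = c).card
  simp only [ENat.toENNReal_coe]
  rw [this, ← Finset.prod_const]
  refine Finset.prod_congr rfl fun i hi => ?_
  rw [(Finset.mem_filter.1 hi).2]

lemma lintegral_voidProd_simpleFunc {S : Type*} [MeasurableSpace S] {μ : Measure S}
    [IsProbabilityMeasure μ] {U : ℕ → S → ℝ} {Λ : Measure ℝ} (hU : IsPoissonPointProcess U Λ μ)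
    (h : SimpleFunc ℝ ℝ≥0∞) (h1 : ∀ u, h u ≤ 1) (hint : ∫⁻ u, h u ∂Λ ≠ ∞) :
    ∫⁻ ω, voidProd h (fun i => U i ω) ∂μ = ENNReal.ofReal (Real.exp (-(∫⁻ u, h u ∂Λ).toReal)) := by
  set s := h.range.filter (· ≠ 0) with hs
  have hfm : h.FinMeasSupp Λ := SimpleFunc.FinMeasSupp.of_lintegral_ne_top
    (by rwa [← SimpleFunc.lintegral_eq_lintegral])
  have hΛ : ∀ c ∈ s, Λ (h ⁻¹' {c}) ≠ ∞ := fun c hc =>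
    (SimpleFunc.finMeasSupp_iff.1 hfm c (Finset.mem_filter.1 hc).2).ne
  have hc1 : ∀ c ∈ s, c ≤ 1 := by
    intro c hc
    obtain ⟨u, rfl⟩ := SimpleFunc.mem_range.1 (Finset.mem_filter.1 hc).1
    exact h1 u
  have hNm : ∀ c, Measurable fun ω => pointMeasure U ω (h ⁻¹' {c}) := fun c =>
    measurable_pointMeasure_apply hU.measurable (h.measurableSet_fiber c)
  have hae : ∀ᵐ ω ∂μ, ∀ c ∈ s, pointMeasure U ω (h ⁻¹' {c}) ≠ ∞ := by
    rw [Filter.eventually_all_finset]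
    intro c hc
    exact ae_ne_top_of_poisson (hNm c) ENNReal.toReal_nonneg
      (hU.poisson _ (h.measurableSet_fiber c) (hΛ c hc))
  have e1 : ∫⁻ ω, voidProd h (fun i => U i ω) ∂μ =
      ∫⁻ ω, ∏ c ∈ s, powCount (1 - c) (pointMeasure U ω (h ⁻¹' {c})) ∂μ := by
    refine lintegral_congr_ae ?_
    filter_upwards [hae] with ω hω
    exact voidProd_simpleFunc_eq U ω h hω
  -- The independence of the counts is stated for families indexed by `Fin m`.
  let e := s.equivFin
  have hind : iIndepFun (fun (j : Fin s.card) (ω : S) =>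
      pointMeasure U ω (h ⁻¹' {((e.symm j : s) : ℝ≥0∞)})) μ := by
    refine hU.indep s.card _ (fun j => h.measurableSet_fiber _) fun j k hjk => ?_
    refine Set.disjoint_left.2 fun u hu hu' => hjk ?_
    simp only [Set.mem_preimage, Set.mem_singleton_iff] at hu hu'
    exact e.symm.injective (Subtype.ext (hu.symm.trans hu'))
  have hind' := hind.comp (fun j => powCount (1 - ((e.symm j : s) : ℝ≥0∞)))
    (fun j => measurable_powCount _)
  have e2 := lintegral_prod_eq_prod_lintegral_of_indepFun Finset.univ _ hind'
    (fun j => (measurable_powCount _).comp (hNm _))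
  have conv : ∀ f : ℝ≥0∞ → ℝ≥0∞, ∏ c ∈ s, f c = ∏ j : Fin s.card, f (e.symm j : s) := by
    intro f
    rw [← Finset.prod_coe_sort, ← Equiv.prod_comp e.symm]
  rw [e1]
  simp_rw [conv]
  refine e2.trans
    ((conv fun c => ∫⁻ ω, powCount (1 - c) (pointMeasure U ω (h ⁻¹' {c})) ∂μ).symm.trans ?_)
  have e3 : ∀ c ∈ s, ∫⁻ ω, powCount (1 - c) (pointMeasure U ω (h ⁻¹' {c})) ∂μ =
      ENNReal.ofReal (Real.exp (-(c * Λ (h ⁻¹' {c})).toReal)) := by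
    intro c hc
    rw [lintegral_powCount_poisson (hNm c) ENNReal.toReal_nonneg
      (hU.poisson _ (h.measurableSet_fiber c) (hΛ c hc))
      ((tsub_le_self.trans_lt ENNReal.one_lt_top).ne)]
    rw [ENNReal.toReal_sub_of_le (hc1 c hc) ENNReal.one_ne_top, ENNReal.toReal_mul]
    simp [mul_comm]
  rw [Finset.prod_congr rfl e3, ← ENNReal.ofReal_prod_of_nonneg (fun _ _ => (Real.exp_pos _).le),
    ← Real.exp_sum, Finset.sum_neg_distrib]
  congr 3
  rw [SimpleFunc.lintegral_eq_lintegral, SimpleFunc.lintegral, ← ENNReal.toReal_sum]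
  · congr 1
    rw [hs, Finset.sum_filter_of_ne]
    intro c _ hc h0
    simp [h0] at hc
  · intro c hc
    exact ENNReal.mul_ne_top ((hc1 c hc).trans_lt ENNReal.one_lt_top).ne (hΛ c hc)

/-- The generating functional of a Poisson point process:
`𝔼[∏ i, (1 - h (U i))] = exp(-∫ h dΛ)` for measurable `h` with values in `[0, 1]`. -/
theorem lintegral_voidProd {S : Type*} [MeasurableSpace S] {μ : Measure S}
    [IsProbabilityMeasure μ] {U : ℕ → S → ℝ} {Λ : Measure ℝ} (hU : IsPoissonPointProcess U Λ μ)
    {h : ℝ → ℝ≥0∞} (hh : Measurable h) (h1 : ∀ u, h u ≤ 1) (hint : ∫⁻ u, h u ∂Λ ≠ ∞) :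
    ∫⁻ ω, voidProd h (fun i => U i ω) ∂μ = ENNReal.ofReal (Real.exp (-(∫⁻ u, h u ∂Λ).toReal)) := by
  set g := fun n => SimpleFunc.eapprox h n with hg
  have hle : ∀ n u, g n u ≤ h u := fun n u =>
    (le_iSup (fun n => g n u) n).trans_eq (SimpleFunc.iSup_eapprox_apply hh u)
  have hgm : Monotone g := SimpleFunc.monotone_eapprox h
  have hUm : Measurable fun ω i => U i ω := measurable_pi_iff.2 hU.measurable
  have hinf : ∀ u, voidProd h u = ⨅ n, voidProd (g n) u := by
    intro u
    unfold voidProd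
    rw [iInf_comm]
    refine iInf_congr fun I => ?_
    have ht : Tendsto (fun n => ∏ i ∈ I, (1 - g n (u i))) atTop (𝓝 (∏ i ∈ I, (1 - h (u i)))) := by
      refine ENNReal.tendsto_finsetProd_of_ne_top I (fun i _ => ?_) fun i _ => ?_
      · exact ENNReal.Tendsto.sub tendsto_const_nhds (SimpleFunc.tendsto_eapprox hh _)
          (Or.inl ENNReal.one_ne_top)
      · exact (tsub_le_self.trans_lt ENNReal.one_lt_top).ne
    refine tendsto_nhds_unique ht (tendsto_atTop_iInf fun m n hmn => ?_)
    exact Finset.prod_le_prod' fun i _ => tsub_le_tsub_left (hgm hmn _) _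
  have hanti : Antitone fun n ω => voidProd (g n) (fun i => U i ω) := fun m n hmn ω =>
    iInf_mono fun I => Finset.prod_le_prod' fun i _ => tsub_le_tsub_left (hgm hmn _) _
  have hmeas : ∀ n, Measurable fun ω => voidProd (g n) (fun i => U i ω) := fun n =>
    (measurable_voidProd (g n).measurable).comp hUm
  have hlim : Tendsto (fun n => ∫⁻ u, g n u ∂Λ) atTop (𝓝 (∫⁻ u, h u ∂Λ)) :=
    lintegral_tendsto_of_tendsto_of_monotone (fun n => (g n).measurable.aemeasurable)
      (ae_of_all _ fun u m n hmn => hgm hmn u)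
      (ae_of_all _ fun u => SimpleFunc.tendsto_eapprox hh u)
  simp_rw [hinf]
  rw [lintegral_iInf hmeas hanti]
  · have e : ∀ n, ∫⁻ ω, voidProd (g n) (fun i => U i ω) ∂μ =
        ENNReal.ofReal (Real.exp (-(∫⁻ u, g n u ∂Λ).toReal)) := fun n =>
      lintegral_voidProd_simpleFunc hU (g n) (fun u => (hle n u).trans (h1 u))
        (ne_top_of_le_ne_top hint (lintegral_mono (hle n)))
    refine tendsto_nhds_unique
      (tendsto_atTop_iInf fun m n hmn => lintegral_mono (hanti hmn)) ?_
    simp_rw [e]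
    refine ENNReal.tendsto_ofReal ((Real.continuous_exp.tendsto _).comp ?_)
    exact ((ENNReal.tendsto_toReal hint).comp hlim).neg
  · exact ((lintegral_mono fun ω => voidProd_le_one _ _).trans_lt (by simp)).ne

/-! ### Void probabilities of the marked Poisson process -/

/-- The probability of countably many independent events occurring together, as an infimum of
finite products. -/
lemma measure_forall_mem_eq_iInf {ι S β : Type*} [Countable ι] [MeasurableSpace S]
    [MeasurableSpace β] {μ : Measure S} [IsProbabilityMeasure μ] {X : ι → S → β}
    (hX : iIndepFun X μ) (hm : ∀ i, AEMeasurable (X i) μ) {B : ι → Set β}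
    (hB : ∀ i, MeasurableSet (B i)) :
    μ {ω | ∀ i, X i ω ∈ B i} = ⨅ I : Finset ι, ∏ i ∈ I, μ (X i ⁻¹' B i) := by
  have h1 : {ω | ∀ i, X i ω ∈ B i} = ⋂ I : Finset ι, ⋂ i ∈ I, X i ⁻¹' B i := by
    ext ω
    simp only [Set.mem_ofPred_eq, Set.mem_iInter, Set.mem_preimage]
    exact ⟨fun h I i _ => h i, fun h i => h {i} i (Finset.mem_singleton_self i)⟩
  rw [h1, Antitone.measure_iInter]
  · refine iInf_congr fun I => ?_
    exact hX.meas_biInter fun i _ => ⟨B i, hB i, rfl⟩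
  · intro I J hIJ
    exact Set.biInter_subset_biInter_left hIJ
  · intro I
    exact NullMeasurableSet.biInter I.countable_toSet fun i _ => (hm i).nullMeasurable (hB i)
  · exact ⟨∅, measure_ne_top _ _⟩

lemma inverseSquareMeasure_lt_mul (z : ℝ) :
    inverseSquareMeasure {u | 1 < u * z} = ENNReal.ofReal z := by
  have hm : MeasurableSet {u : ℝ | 1 < u * z} :=
    measurableSet_lt measurable_const (measurable_id.mul_const z)
  rw [inverseSquareMeasure, withDensity_apply _ hm, Measure.restrict_restrict hm]
  rcases le_or_gt z 0 with hz | hz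
  · have : {u : ℝ | 1 < u * z} ∩ Set.Ioi 0 = ∅ := by
      ext u
      simp only [Set.mem_inter_iff, Set.mem_ofPred_eq, Set.mem_Ioi, Set.mem_empty_iff_false,
        iff_false, not_and, not_lt]
      intro h
      by_contra! hu
      nlinarith [mul_nonneg hu.le (neg_nonneg.2 hz)]
    simp [this, ENNReal.ofReal_of_nonpos hz]
  · have hc : 0 < z⁻¹ := inv_pos.2 hz
    have : {u : ℝ | 1 < u * z} ∩ Set.Ioi 0 = Set.Ioi z⁻¹ := by
      ext u
      simp only [Set.mem_inter_iff, Set.mem_ofPred_eq, Set.mem_Ioi]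
      rw [← div_lt_iff₀ hz, one_div]
      exact ⟨fun h => h.1, fun h => ⟨h, hc.trans h⟩⟩
    have hint := integrableOn_Ioi_rpow_of_lt (a := -2) (by norm_num) hc
    have hval := integral_Ioi_rpow_of_lt (a := -2) (by norm_num) hc
    rw [this]
    calc ∫⁻ u in Set.Ioi z⁻¹, ENNReal.ofReal ((u ^ 2)⁻¹)
        = ∫⁻ u in Set.Ioi z⁻¹, ENNReal.ofReal (u ^ (-2 : ℝ)) := by
          refine setLIntegral_congr_fun measurableSet_Ioi fun u hu => ?_
          have hu0 : 0 ≤ u := (hc.trans hu).le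
          simp only [Real.rpow_neg hu0, Real.rpow_two]
      _ = ENNReal.ofReal (∫ u in Set.Ioi z⁻¹, u ^ (-2 : ℝ)) := by
          refine (ofReal_integral_eq_lintegral_ofReal hint ?_).symm
          refine (ae_restrict_iff' measurableSet_Ioi).2 (ae_of_all _ fun u hu => ?_)
          exact Real.rpow_nonneg (hc.trans hu).le _
      _ = ENNReal.ofReal z := by
          rw [hval]
          norm_num
          rw [Real.rpow_neg_one, inv_inv]

instance : SFinite inverseSquareMeasure := by
  unfold inverseSquareMeasure
  infer_instance

/-- Integrating the tail `Q[u Z > 1]` against `u⁻² du` gives the mean of `Z`. -/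
lemma lintegral_inverseSquareMeasure_tail {Ω' : Type*} [MeasurableSpace Ω'] {Q : Measure Ω'}
    [IsProbabilityMeasure Q] {Z : Ω' → ℝ} (hZ : Measurable Z) :
    Measurable (fun u => Q {ω | 1 < u * Z ω}) ∧
      ∫⁻ u, Q {ω | 1 < u * Z ω} ∂inverseSquareMeasure = ∫⁻ ω, ENNReal.ofReal (Z ω) ∂Q := by
  have hm : MeasurableSet {p : ℝ × Ω' | 1 < p.1 * Z p.2} :=
    measurableSet_lt measurable_const (measurable_fst.mul (hZ.comp measurable_snd))
  refine ⟨measurable_measure_prodMk_left hm, ?_⟩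
  have h1 := Measure.prod_apply (μ := inverseSquareMeasure) (ν := Q) hm
  have h2 := Measure.prod_apply_symm (μ := inverseSquareMeasure) (ν := Q) hm
  calc _ = _ := h1.symm
    _ = _ := h2
    _ = _ := lintegral_congr fun ω => inverseSquareMeasure_lt_mul (Z ω)

/-- The void probability of the marked Poisson process: if the `V i` are independent copies of `Z`,
independent of the Poisson points `U i`, then no `U i * V i` exceeds `1` with probability
`exp(-𝔼 Z)`. -/
theorem measure_forall_mul_le_one {S Ω' : Type*} [MeasurableSpace S] [MeasurableSpace Ω']
    {μ : Measure S} [IsProbabilityMeasure μ] {Q : Measure Ω'} [IsProbabilityMeasure Q]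
    {U V : ℕ → S → ℝ} {Z : Ω' → ℝ} (hU : IsPoissonPointProcess U inverseSquareMeasure μ)
    (hV : ∀ i, IdentDistrib (V i) Z μ Q) (hVind : iIndepFun V μ)
    (hUV : IndepFun (fun ω i => U i ω) (fun ω i => V i ω) μ)
    (hZ : Measurable Z) (hZ0 : ∀ᵐ ω ∂Q, 0 ≤ Z ω) (hZi : Integrable Z Q) :
    μ {ω | ∀ i, U i ω * V i ω ≤ 1} = ENNReal.ofReal (Real.exp (-∫ ω, Z ω ∂Q)) := by
  set h : ℝ → ℝ≥0∞ := fun u => Q {ω | 1 < u * Z ω} with hdef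
  obtain ⟨hh, hint⟩ := lintegral_inverseSquareMeasure_tail (Q := Q) hZ
  have hZint : ∫⁻ ω, ENNReal.ofReal (Z ω) ∂Q = ENNReal.ofReal (∫ ω, Z ω ∂Q) :=
    (ofReal_integral_eq_lintegral_ofReal hZi hZ0).symm
  have hUm : Measurable fun ω i => U i ω := measurable_pi_iff.2 hU.measurable
  have hVm : AEMeasurable (fun ω i => V i ω) μ :=
    aemeasurable_pi_iff.2 fun i => (hV i).aemeasurable_fst
  have hE : MeasurableSet {p : (ℕ → ℝ) × (ℕ → ℝ) | ∀ i, p.1 i * p.2 i ≤ 1} := by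
    rw [Set.ofPred_forall]
    refine MeasurableSet.iInter fun i => measurableSet_le ?_ measurable_const
    exact ((measurable_pi_apply i).comp measurable_fst).mul
      ((measurable_pi_apply i).comp measurable_snd)
  have hprod := (indepFun_iff_map_prod_eq_prod_map_map hUm.aemeasurable hVm).1 hUV
  -- For fixed points `u i`, the independence of the marks gives a product.
  have hsec : ∀ u : ℕ → ℝ, μ {ω | ∀ i, u i * V i ω ≤ 1} = voidProd h u := by
    intro u
    have hB : ∀ i, MeasurableSet {x : ℝ | u i * x ≤ 1} := fun i =>
      measurableSet_le (measurable_id.const_mul (u i)) measurable_const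
    refine (measure_forall_mem_eq_iInf hVind (fun i => (hV i).aemeasurable_fst) hB).trans ?_
    refine iInf_congr fun I => Finset.prod_congr rfl fun i _ => ?_
    rw [(hV i).measure_mem_eq (hB i), hdef, ← prob_compl_eq_one_sub]
    · congr 1
      ext ω
      simp
    · exact measurableSet_lt measurable_const (hZ.const_mul (u i))
  have key : μ {ω | ∀ i, U i ω * V i ω ≤ 1} = ∫⁻ ω, voidProd h (fun i => U i ω) ∂μ := by
    have : μ {ω | ∀ i, U i ω * V i ω ≤ 1} =
        μ.map (fun ω => ((fun i => U i ω), (fun i => V i ω)))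
          {p : (ℕ → ℝ) × (ℕ → ℝ) | ∀ i, p.1 i * p.2 i ≤ 1} := by
      rw [Measure.map_apply_of_aemeasurable (hUm.aemeasurable.prodMk hVm) hE]
      rfl
    rw [this, hprod, Measure.prod_apply hE,
      lintegral_map (measurable_measure_prodMk_left hE) hUm]
    refine lintegral_congr fun ω => ?_
    rw [← hsec, Measure.map_apply_of_aemeasurable hVm (measurable_prodMk_left hE)]
    rfl
  rw [key, lintegral_voidProd hU hh (fun u => prob_le_one)]
  · rw [hint, hZint, ENNReal.toReal_ofReal (integral_nonneg_of_ae hZ0)]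
  · rw [hint, hZint]
    exact ENNReal.ofReal_ne_top

/-! ### Finite-dimensional distributions of a max-stable process -/

/-- The largest of the weighted values `w j * f (s + j)`, `0 ≤ j ≤ k`. -/
noncomputable def windowMax (s : ℤ) (k : ℕ) (w : ℕ → ℝ) (f : ℤ → ℝ) : ℝ :=
  partialSups (fun j : ℕ => w j * f (s + j)) k

/-- The sequences `x` with `w j * x (s + j) ≤ 1` for all `0 ≤ j ≤ k`, for weights `w j ≥ 0`: a
vanishing weight means no constraint. -/
def window (s : ℤ) (k : ℕ) (w : ℕ → ℝ) : Set (ℤ → EReal) :=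
  {x | ∀ j ≤ k, 0 < w j → x (s + j) ≤ (((w j)⁻¹ : ℝ) : EReal)}

lemma measurableSet_window (s : ℤ) (k : ℕ) (w : ℕ → ℝ) : MeasurableSet (window s k w) := by
  simp only [window, Set.ofPred_forall]
  exact MeasurableSet.iInter fun j => MeasurableSet.iInter fun _ => MeasurableSet.iInter fun _ =>
    measurableSet_le (measurable_pi_apply _) measurable_const

lemma windowMax_zero (s : ℤ) (w : ℕ → ℝ) (f : ℤ → ℝ) : windowMax s 0 w f = w 0 * f s := by
  simp [windowMax]

lemma windowMax_succ (s : ℤ) (k : ℕ) (w : ℕ → ℝ) (f : ℤ → ℝ) :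
    windowMax s (k + 1) w f = max (windowMax s k w f) (w (k + 1) * f (s + k + 1)) := by
  simp [windowMax, partialSups_add_one, add_assoc]

lemma windowMax_le_iff {s : ℤ} {k : ℕ} {w : ℕ → ℝ} {f : ℤ → ℝ} {c : ℝ} :
    windowMax s k w f ≤ c ↔ ∀ j ≤ k, w j * f (s + j) ≤ c :=
  partialSups_le_iff

lemma measurable_windowMax (s : ℤ) (k : ℕ) (w : ℕ → ℝ) : Measurable (windowMax s k w) := by
  induction k with
  | zero =>
    simp only [funext (windowMax_zero s w)]
    exact (measurable_pi_apply s).const_mul _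
  | succ k ih =>
    simp only [funext (windowMax_succ s k w)]
    exact ih.max ((measurable_pi_apply _).const_mul _)

lemma integrable_windowMax {Ω' : Type*} [MeasurableSpace Ω'] {Q : Measure Ω'} {Y : Ω' → ℤ → ℝ}
    (hY : ∀ t, Integrable (fun ω => Y ω t) Q) (s : ℤ) (k : ℕ) (w : ℕ → ℝ) :
    Integrable (fun ω => windowMax s k w (Y ω)) Q := by
  induction k with
  | zero =>
    simp only [windowMax_zero]
    exact (hY s).const_mul _
  | succ k ih =>
    simp only [windowMax_succ]
    exact ih.sup ((hY _).const_mul _)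

lemma windowMax_nonneg {s : ℤ} {k : ℕ} {w : ℕ → ℝ} {f : ℤ → ℝ} (hw : ∀ j, 0 ≤ w j)
    (hf : ∀ t, 0 ≤ f t) : 0 ≤ windowMax s k w f :=
  (mul_nonneg (hw 0) (hf _)).trans (windowMax_le_iff.1 le_rfl 0 (Nat.zero_le k))

lemma IsPoissonPointProcess.ae_pos {S : Type*} [MeasurableSpace S] {μ : Measure S}
    [IsProbabilityMeasure μ] {U : ℕ → S → ℝ}
    (hU : IsPoissonPointProcess U inverseSquareMeasure μ) : ∀ᵐ ω ∂μ, ∀ i, 0 < U i ω := by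
  have hΛ : inverseSquareMeasure (Set.Iic 0) = 0 := by
    rw [inverseSquareMeasure, withDensity_apply _ measurableSet_Iic,
      Measure.restrict_restrict measurableSet_Iic]
    simp [Set.Iic_inter_Ioi]
  have h0 := hU.poisson (Set.Iic 0) measurableSet_Iic (by simp [hΛ]) 0
  have hm : MeasurableSet {ω | pointMeasure U ω (Set.Iic 0) = ((0 : ℕ) : ℝ≥0∞)} :=
    measurable_pointMeasure_apply hU.measurable measurableSet_Iic (measurableSet_singleton _)
  have h1 : ∀ᵐ ω ∂μ, pointMeasure U ω (Set.Iic 0) = ((0 : ℕ) : ℝ≥0∞) := by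
    refine (prob_compl_eq_zero_iff hm).2 ?_
    rw [h0]
    simp [hΛ]
  filter_upwards [h1] with ω hω i
  rw [pointMeasure_apply U ω measurableSet_Iic, Nat.cast_zero, ENNReal.tsum_eq_zero] at hω
  have := hω i
  by_contra! hi
  simp [hi] at this

/-- The finite-dimensional distributions of a max-stable process with spectral process `Y`:
`ℙ[w j * η (s + j) ≤ 1, j ≤ k] = exp(-𝔼[max_j w j * Y (s + j)])`. -/
theorem IsDeHaanRepresentation.measure_window {Ω Ω' S : Type*} [MeasurableSpace Ω]
    [MeasurableSpace Ω'] [MeasurableSpace S] {η : Ω → ℤ → ℝ} {P : Measure Ω} {Y : Ω' → ℤ → ℝ}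
    {Q : Measure Ω'} [IsProbabilityMeasure Q] {U : ℕ → S → ℝ} {Y' : ℕ → S → ℤ → ℝ}
    {μ : Measure S} [IsProbabilityMeasure μ] (hY : IsDeHaanRepresentation η P Y Q U Y' μ)
    (s : ℤ) (k : ℕ) {w : ℕ → ℝ} (hw : ∀ j, 0 ≤ w j) :
    P {ω | (fun t => ((η ω t : ℝ) : EReal)) ∈ window s k w} =
      ENNReal.ofReal (Real.exp (-∫ ω, windowMax s k w (Y ω) ∂Q)) := by
  have hm := measurable_windowMax s k w
  rw [← measure_forall_mul_le_one (V := fun i ω => windowMax s k w (Y' i ω)) hY.poisson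
    (fun i => (hY.copies i).comp hm) (hY.copies_indep.comp _ fun _ => hm)
    (hY.indep.comp measurable_id (measurable_pi_iff.2 fun i => hm.comp (measurable_pi_apply i)))
    (Z := fun ω => windowMax s k w (Y ω)) (hm.comp hY.measurable) ?_
    (integrable_windowMax hY.integrable s k w)]
  · refine (hY.representation.measure_mem_eq (measurableSet_window s k w)).trans ?_
    refine measure_congr ?_
    filter_upwards [hY.poisson.ae_pos] with ω hω
    refine propext ?_
    change (∀ j ≤ k, 0 < w j → ⨆ i : ℕ, ((U i ω * Y' i ω (s + j) : ℝ) : EReal) ≤ _) ↔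
      ∀ i, U i ω * windowMax s k w (Y' i ω) ≤ 1
    simp only [iSup_le_iff, EReal.coe_le_coe_iff]
    constructor
    · intro h i
      rw [mul_comm, ← le_div_iff₀ (hω i), windowMax_le_iff]
      intro j hj
      rw [le_div_iff₀ (hω i)]
      rcases (hw j).eq_or_lt with h0 | h0
      · simp [← h0]
      · have := h j hj h0 i
        rw [← one_div, le_div_iff₀ h0] at this
        linarith
    · intro h j hj h0 i
      have := h i
      rw [mul_comm, ← le_div_iff₀ (hω i), windowMax_le_iff] at this
      have := this j hj
      rw [le_div_iff₀ (hω i)] at this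
      rw [← one_div, le_div_iff₀ h0]
      linarith
  · filter_upwards [hY.nonneg] with ω hω using windowMax_nonneg hw hω

/-! ### Finite-dimensional distributions of the max-AR(1) process -/

/-- The exponent of the finite-dimensional distributions of the max-AR(1) process, see
`measure_maxAR_window`. The recursion removes the last time of the window: the constraint
`w (k + 1) * X (s + k + 1) ≤ 1` splits into a constraint on the innovation at time `s + k + 1` and
the constraint `a * w (k + 1) * X (s + k) ≤ 1`. -/
noncomputable def arExponent (a : ℝ) : ℕ → (ℕ → ℝ) → ℝ
  | 0, w => w 0
  | k + 1, w => arExponent a k (Function.update w k (max (w k) (a * w (k + 1)))) +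
      (1 - a) * w (k + 1)

lemma update_max_nonneg (a : ℝ) {w : ℕ → ℝ} (hw : ∀ j, 0 ≤ w j)
    (k j : ℕ) :
    0 ≤ Function.update w k (max (w k) (a * w (k + 1))) j := by
  rcases eq_or_ne j k with rfl | h
  · simp [hw]
  · simp [h, hw]

/-- The event `v * X_a(t) ≤ 1` expressed through the innovations. -/
def IsBelow (a : ℝ) (F : ℤ → ℝ) (t : ℤ) (v : ℝ) : Prop :=
  (a = 1 → v * F 0 ≤ 1) ∧ (a ≠ 1 → ∀ n ≤ t, v * ((1 - a) * a ^ (t - n) * F n) ≤ 1)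

lemma maxAR_le_inv_iff {T : Type*} {a : ℝ} {F : ℤ → T → ℝ} {ω : T} {t : ℤ} {v : ℝ} (hv : 0 ≤ v) :
    (0 < v → maxAR a F ω t ≤ ((v⁻¹ : ℝ) : EReal)) ↔ IsBelow a (fun n => F n ω) t v := by
  rcases hv.eq_or_lt with rfl | hv
  · simp [IsBelow]
  by_cases ha : a = 1
  · simp only [maxAR, IsBelow, ha, hv, if_true, EReal.coe_le_coe_iff, forall_true_left, ne_eq,
      not_true_eq_false, false_imp_iff, and_true, ← one_div, le_div_iff₀ hv, mul_comm]
  · simp only [maxAR, IsBelow, ha, hv, if_false, iSup_le_iff, EReal.coe_le_coe_iff,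
      forall_true_left, ne_eq, not_false_eq_true, false_imp_iff, true_and, ← one_div,
      le_div_iff₀ hv, mul_comm v]

lemma max_mul_le_one_iff {v v' x : ℝ} (hv : 0 ≤ v) (hv' : 0 ≤ v') :
    max v v' * x ≤ 1 ↔ v * x ≤ 1 ∧ v' * x ≤ 1 := by
  rcases le_total 0 x with hx | hx
  · rw [max_mul_of_nonneg _ _ hx, max_le_iff]
  · have h : ∀ y : ℝ, 0 ≤ y → y * x ≤ 1 := fun y hy =>
      (mul_nonpos_of_nonneg_of_nonpos hy hx).trans zero_le_one
    simp [h v hv, h v' hv', h _ (hv.trans (le_max_left v v'))]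

lemma isBelow_max_iff {a : ℝ} {F : ℤ → ℝ} {t : ℤ} {v v' : ℝ} (hv : 0 ≤ v) (hv' : 0 ≤ v') :
    IsBelow a F t (max v v') ↔ IsBelow a F t v ∧ IsBelow a F t v' := by
  simp only [IsBelow, max_mul_le_one_iff hv hv', forall_and]
  tauto

lemma isBelow_succ_iff {a : ℝ} {F : ℤ → ℝ} {t : ℤ} {v : ℝ} :
    IsBelow a F (t + 1) v ↔ (1 - a) * v * F (t + 1) ≤ 1 ∧ IsBelow a F t (a * v) := by
  by_cases ha : a = 1
  · simp [IsBelow, ha]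
  have hpow : ∀ n ≤ t, v * ((1 - a) * a ^ (t + 1 - n) * F n) =
      a * v * ((1 - a) * a ^ (t - n) * F n) := by
    intro n hn
    obtain ⟨m, hm⟩ := Int.eq_ofNat_of_zero_le (sub_nonneg.2 hn)
    rw [show t + 1 - n = ((m + 1 : ℕ) : ℤ) by push_cast; omega, hm, zpow_natCast, zpow_natCast,
      pow_succ]
    ring
  simp only [IsBelow, ha, false_imp_iff, true_and, ne_eq, not_false_eq_true, forall_true_left]
  constructor
  · intro h
    refine ⟨?_, fun n hn => ?_⟩
    · have := h (t + 1) le_rfl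
      simp only [sub_self, zpow_zero, mul_one] at this
      linarith
    · rw [← hpow n hn]
      exact h n (by omega)
  · rintro ⟨h1, h2⟩ n hn
    rcases hn.eq_or_lt with rfl | hn
    · simp only [sub_self, zpow_zero, mul_one]
      linarith
    · rw [hpow n (by omega)]
      exact h2 n (by omega)

/-- The base case of `exists_innovation_weights`: the constraint at a single time. -/
lemma exists_innovation_weights_single {a : ℝ} (ha₀ : 0 ≤ a) (ha₁ : a ≤ 1) (s : ℤ) {v : ℝ}
    (hv : 0 ≤ v) :
    ∃ d : ℤ → ℝ, (∀ n, 0 ≤ d n) ∧ HasSum d v ∧ (a = 1 ∨ ∀ n, s < n → d n = 0) ∧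
      ∀ F : ℤ → ℝ, IsBelow a F s v ↔ ∀ n, d n * F n ≤ 1 := by
  rcases ha₁.eq_or_lt with rfl | ha₁
  · refine ⟨Pi.single 0 v, fun n => ?_, hasSum_pi_single 0 v, Or.inl rfl, fun F => ?_⟩
    · rcases eq_or_ne n 0 with rfl | hn
      · simpa using hv
      · simp [hn]
    · simp only [IsBelow, forall_true_left, ne_eq, not_true_eq_false, false_imp_iff, and_true]
      constructor
      · intro h n
        rcases eq_or_ne n 0 with rfl | hn
        · simpa using h
        · simp [hn]
      · intro h
        simpa using h 0
  · refine ⟨fun n => if n ≤ s then v * ((1 - a) * a ^ (s - n)) else 0, fun n => ?_, ?_,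
      Or.inr fun n hn => ?_, fun F => ?_⟩
    · dsimp only
      split_ifs
      · exact mul_nonneg hv (mul_nonneg (by linarith) (zpow_nonneg ha₀ _))
      · exact le_rfl
    · have hinj : Function.Injective fun m : ℕ => s - (m : ℤ) := by
        intro m m' h
        simp only at h
        omega
      refine (hinj.hasSum_iff ?_).1 ?_
      · intro n hn
        refine if_neg fun hns => hn ⟨(s - n).toNat, ?_⟩
        simp only
        omega
      · have h := ((hasSum_geometric_of_lt_one ha₀ ha₁).mul_left (v * (1 - a)))
        rw [mul_assoc, mul_inv_cancel₀ (by linarith), mul_one] at h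
        refine h.congr_fun fun m => ?_
        simp [mul_assoc]
    · simp [not_le.2 hn]
    · have ha : a ≠ 1 := ha₁.ne
      simp only [IsBelow, ha, false_imp_iff, true_and, ne_eq, not_false_eq_true, forall_true_left]
      refine forall_congr' fun n => ?_
      split_ifs with h
      · simp [h, mul_assoc]
      · simp [h]

/-- The constraints `w j * X_a(s + j) ≤ 1`, `j ≤ k`, amount to separate constraints on the
innovations. -/
lemma exists_innovation_weights {a : ℝ} (ha₀ : 0 ≤ a) (ha₁ : a ≤ 1) (s : ℤ) (k : ℕ) {w : ℕ → ℝ}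
    (hw : ∀ j, 0 ≤ w j) :
    ∃ d : ℤ → ℝ, (∀ n, 0 ≤ d n) ∧ HasSum d (arExponent a k w) ∧
      (a = 1 ∨ ∀ n, s + k < n → d n = 0) ∧
      ∀ F : ℤ → ℝ, (∀ j ≤ k, IsBelow a F (s + j) (w j)) ↔ ∀ n, d n * F n ≤ 1 := by
  induction k generalizing w with
  | zero =>
    obtain ⟨d, h1, h2, h3, h4⟩ := exists_innovation_weights_single ha₀ ha₁ s (hw 0)
    exact ⟨d, h1, h2, by simpa using h3, fun F => by simpa using h4 F⟩
  | succ k ih =>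
    set w' := Function.update w k (max (w k) (a * w (k + 1))) with hw'
    obtain ⟨d, h1, h2, h3, h4⟩ := ih (update_max_nonneg a hw k)
    have hc : 0 ≤ (1 - a) * w (k + 1) := mul_nonneg (by linarith) (hw _)
    obtain ⟨e, he, he_self, he_ne⟩ : ∃ e : ℤ → ℝ, HasSum e ((1 - a) * w (k + 1)) ∧
        e (s + k + 1) = (1 - a) * w (k + 1) ∧ ∀ n, n ≠ s + k + 1 → e n = 0 :=
      ⟨Pi.single (s + k + 1) _, hasSum_pi_single _ _, Pi.single_eq_same _ _,
        fun n hn => Pi.single_eq_of_ne hn _⟩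
    refine ⟨d + e, fun n => ?_, h2.add he, ?_, fun F => ?_⟩
    · refine add_nonneg (h1 n) ?_
      rcases eq_or_ne n (s + k + 1) with rfl | hn
      · simpa [he_self] using hc
      · simp [he_ne n hn]
    · refine h3.imp_right fun h n hn => ?_
      push_cast at hn
      rw [Pi.add_apply, h n (by omega), he_ne n (by omega), add_zero]
    · have e1 : (∀ j ≤ k + 1, IsBelow a F (s + j) (w j)) ↔
          (1 - a) * w (k + 1) * F (s + k + 1) ≤ 1 ∧ ∀ j ≤ k, IsBelow a F (s + j) (w' j) := by
        constructor
        · intro h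
          have hlast := h (k + 1) le_rfl
          rw [Nat.cast_add_one, ← add_assoc, isBelow_succ_iff] at hlast
          refine ⟨hlast.1, fun j hj => ?_⟩
          rcases eq_or_ne j k with rfl | hjk
          · rw [hw', Function.update_self, isBelow_max_iff (hw _) (mul_nonneg ha₀ (hw _))]
            exact ⟨h j (by omega), hlast.2⟩
          · rw [hw', Function.update_of_ne hjk]
            exact h j (by omega)
        · rintro ⟨hF, h⟩
          have hk := h k le_rfl
          rw [hw', Function.update_self, isBelow_max_iff (hw _) (mul_nonneg ha₀ (hw _))] at hk
          intro j hj
          rcases eq_or_ne j (k + 1) with rfl | hj1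
          · rw [Nat.cast_add_one, ← add_assoc, isBelow_succ_iff]
            exact ⟨hF, hk.2⟩
          rcases eq_or_ne j k with rfl | hjk
          · exact hk.1
          · have := h j (by omega)
            rwa [hw', Function.update_of_ne hjk] at this
      rw [e1, h4]
      simp only [Pi.add_apply]
      have ha_self : a = 1 → e (s + k + 1) = 0 := fun ha => by simp [he_self, ha]
      constructor
      · rintro ⟨hF, h⟩ n
        rcases eq_or_ne n (s + k + 1) with rfl | hn
        · rcases h3 with ha | h3
          · simpa [ha_self ha] using h (s + k + 1)
          · rw [h3 _ (by omega), he_self, zero_add]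
            exact hF
        · rw [he_ne n hn, add_zero]
          exact h n
      · intro h
        refine ⟨?_, fun n => ?_⟩
        · rcases h3 with ha | h3
          · simp [ha]
          · have := h (s + k + 1)
            rwa [h3 _ (by omega), he_self, zero_add] at this
        · rcases eq_or_ne n (s + k + 1) with rfl | hn
          · rcases h3 with ha | h3
            · simpa [ha_self ha] using h (s + k + 1)
            · rw [h3 _ (by omega)]
              simp
          · have := h n
            rwa [he_ne n hn, add_zero] at this

lemma HasFrechetLaw.measure_mul_le_one {T : Type*} [MeasurableSpace T] {P' : Measure T}
    [IsProbabilityMeasure P'] {X : T → ℝ} (hX : HasFrechetLaw X P') {d : ℝ} (hd : 0 ≤ d) :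
    P' {ω | d * X ω ≤ 1} = ENNReal.ofReal (Real.exp (-d)) := by
  rcases hd.eq_or_lt with rfl | hd
  · simp
  · have h := hX.2 d⁻¹ (inv_pos.2 hd)
    rw [show -1 / d⁻¹ = -d by field_simp] at h
    rw [← h]
    congr 1
    ext ω
    simp only [Set.mem_ofPred_eq]
    rw [← one_div, le_div_iff₀ hd, mul_comm]

lemma measure_forall_mul_le_one_frechet {T : Type*} [MeasurableSpace T] {P' : Measure T}
    [IsProbabilityMeasure P'] {F : ℤ → T → ℝ} (hF : iIndepFun F P')
    (hlaw : ∀ n, HasFrechetLaw (F n) P') {d : ℤ → ℝ} (hd : ∀ n, 0 ≤ d n) {D : ℝ}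
    (hD : HasSum d D) :
    P' {ω | ∀ n, d n * F n ω ≤ 1} = ENNReal.ofReal (Real.exp (-D)) := by
  have hB : ∀ n, MeasurableSet {x : ℝ | d n * x ≤ 1} := fun n =>
    measurableSet_le (measurable_id.const_mul _) measurable_const
  have h := measure_forall_mem_eq_iInf hF (fun n => (hlaw n).1) hB
  have hprod : ∀ I : Finset ℤ, ∏ n ∈ I, P' (F n ⁻¹' {x : ℝ | d n * x ≤ 1}) =
      ENNReal.ofReal (Real.exp (-∑ n ∈ I, d n)) := by
    intro I
    rw [← Finset.sum_neg_distrib, Real.exp_sum,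
      ENNReal.ofReal_prod_of_nonneg fun _ _ => (Real.exp_pos _).le]
    exact Finset.prod_congr rfl fun n _ => (hlaw n).measure_mul_le_one (hd n)
  refine h.trans ?_
  simp_rw [hprod]
  refine tendsto_nhds_unique (tendsto_atTop_iInf fun I J hIJ => ?_)
    (ENNReal.tendsto_ofReal ((Real.continuous_exp.tendsto _).comp (Tendsto.neg hD)))
  refine ENNReal.ofReal_le_ofReal (Real.exp_le_exp.2 (neg_le_neg ?_))
  exact Finset.sum_le_sum_of_subset_of_nonneg hIJ fun n _ _ => hd n

/-- The finite-dimensional distributions of the max-AR(1) process. -/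
theorem measure_maxAR_window {T : Type*} [MeasurableSpace T] {P' : Measure T}
    [IsProbabilityMeasure P'] {F : ℤ → T → ℝ} (hF : iIndepFun F P')
    (hlaw : ∀ n, HasFrechetLaw (F n) P') {a : ℝ} (ha₀ : 0 ≤ a) (ha₁ : a ≤ 1) (s : ℤ) (k : ℕ)
    {w : ℕ → ℝ} (hw : ∀ j, 0 ≤ w j) :
    P' {ω | maxAR a F ω ∈ window s k w} = ENNReal.ofReal (Real.exp (-arExponent a k w)) := by
  obtain ⟨d, hd, hsum, -, hiff⟩ := exists_innovation_weights ha₀ ha₁ s k hw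
  rw [← measure_forall_mul_le_one_frechet hF hlaw hd hsum]
  congr 1
  ext ω
  simp only [Set.mem_ofPred_eq, window]
  rw [← hiff fun n => F n ω]
  exact forall₂_congr fun j _ => maxAR_le_inv_iff (hw j)

lemma aemeasurable_maxAR {T : Type*} [MeasurableSpace T] {P' : Measure T} {F : ℤ → T → ℝ}
    (hF : ∀ n, AEMeasurable (F n) P') (a : ℝ) : AEMeasurable (maxAR a F) P' := by
  refine aemeasurable_pi_iff.2 fun t => ?_
  by_cases ha : a = 1
  · simp only [maxAR, ha, if_true]
    exact measurable_coe_real_ereal.comp_aemeasurable (hF 0)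
  · simp only [maxAR, ha, if_false]
    exact AEMeasurable.iSup fun n => AEMeasurable.iSup fun _ =>
      measurable_coe_real_ereal.comp_aemeasurable ((hF n).const_mul _)

/-! ### Windows determine the law -/

/-- The half-spaces `{x | x t ≤ c}`, `c ∈ [-∞, ∞]`, in the space of sequences in `[-∞, ∞]`. -/
def lowerHalfSpaces (t : ℤ) : Set (Set (ℤ → EReal)) :=
  Set.range fun c : EReal => {x | x t ≤ c}

lemma isPiSystem_lowerHalfSpaces (t : ℤ) : IsPiSystem (lowerHalfSpaces t) := by
  rintro _ ⟨c, rfl⟩ _ ⟨c', rfl⟩ -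
  refine ⟨min c c', ?_⟩
  ext x
  simp

lemma generateFrom_piiUnionInter_lowerHalfSpaces :
    (MeasurableSpace.pi : MeasurableSpace (ℤ → EReal)) =
      MeasurableSpace.generateFrom (piiUnionInter lowerHalfSpaces Set.univ) := by
  refine le_antisymm (iSup_le fun t => ?_) (MeasurableSpace.generateFrom_le ?_)
  · rw [BorelSpace.measurable_eq (α := EReal), borel_eq_generateFrom_Iic,
      MeasurableSpace.comap_generateFrom]
    refine MeasurableSpace.generateFrom_mono ?_
    rintro _ ⟨_, ⟨c, rfl⟩, rfl⟩
    exact subset_piiUnionInter (Set.mem_univ t) ⟨c, rfl⟩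
  · rintro _ ⟨I, -, f, hf, rfl⟩
    refine Finset.measurableSet_biInter I fun t ht => ?_
    obtain ⟨c, hc⟩ := hf t ht
    rw [← hc]
    exact measurableSet_le (measurable_pi_apply t) measurable_const

/-- An intersection of half-spaces with positive bounds is a window. -/
lemma exists_window_eq (I : Finset ℤ) {c : ℤ → EReal} (hc : ∀ t ∈ I, 0 < c t) :
    ∃ (s : ℤ) (k : ℕ) (w : ℕ → ℝ), (∀ j, 0 ≤ w j) ∧
      ⋂ t ∈ I, {x : ℤ → EReal | x t ≤ c t} = window s k w := by
  classical
  set N : ℕ := I.sup Int.natAbs with hN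
  have hI : ∀ t ∈ I, t.natAbs ≤ N := fun t ht => Finset.le_sup (f := Int.natAbs) ht
  have hpos : ∀ t ∈ I, 0 ≤ (c t).toReal := fun t ht => EReal.toReal_nonneg (hc t ht).le
  have hpos' : ∀ t ∈ I, c t ≠ ⊤ → 0 < (c t).toReal := fun t ht h => EReal.toReal_pos (hc t ht) h
  have hcoe : ∀ t ∈ I, c t ≠ ⊤ → (((c t).toReal : ℝ) : EReal) = c t := fun t ht h =>
    EReal.coe_toReal h (EReal.bot_lt_zero.trans (hc t ht)).ne'
  refine ⟨-N, 2 * N, fun j => if -(N : ℤ) + j ∈ I ∧ c (-(N : ℤ) + j) ≠ ⊤ then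
    (c (-(N : ℤ) + j)).toReal⁻¹ else 0, fun j => ?_, ?_⟩
  · dsimp only
    split_ifs with h
    · exact inv_nonneg.2 (hpos _ h.1)
    · exact le_rfl
  · ext x
    simp only [Set.mem_iInter, Set.mem_ofPred_eq, window]
    constructor
    · intro h j _ hj
      split_ifs at hj ⊢ with hjI
      · rw [inv_inv, hcoe _ hjI.1 hjI.2]
        exact h _ hjI.1
      · exact absurd hj (lt_irrefl _)
    · intro h t ht
      by_cases htop : c t = ⊤
      · simp [htop]
      · have hb := hI t ht
        obtain ⟨j, hj⟩ : ∃ j : ℕ, -(N : ℤ) + j = t := ⟨(t + N).toNat, by omega⟩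
        have := h j (by omega)
        rw [hj, if_pos ⟨ht, htop⟩, inv_inv, hcoe t ht htop] at this
        exact this (inv_pos.2 (hpos' t ht htop))

/-- A law on `[-∞, ∞]^ℤ` is determined by its values on windows, provided these are the ones of the
max-AR(1) process; bounds `c ≤ 0` are covered since the half-space `{x | x t ≤ 0}` is then null. -/
lemma ext_of_window {μ ν : Measure (ℤ → EReal)} [IsProbabilityMeasure μ] [IsProbabilityMeasure ν]
    {a : ℝ}
    (hμ : ∀ s k (w : ℕ → ℝ), (∀ j, 0 ≤ w j) →
      μ (window s k w) = ENNReal.ofReal (Real.exp (-arExponent a k w)))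
    (hν : ∀ s k (w : ℕ → ℝ), (∀ j, 0 ≤ w j) →
      ν (window s k w) = ENNReal.ofReal (Real.exp (-arExponent a k w))) : μ = ν := by
  have hzero : ∀ ρ : Measure (ℤ → EReal), (∀ s k (w : ℕ → ℝ), (∀ j, 0 ≤ w j) →
      ρ (window s k w) = ENNReal.ofReal (Real.exp (-arExponent a k w))) →
      ∀ t, ρ {x | x t ≤ 0} = 0 := by
    intro ρ hρ t
    have hle : ∀ n : ℕ, ρ {x | x t ≤ 0} ≤ ENNReal.ofReal (Real.exp (-(n : ℝ))) := by
      intro n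
      refine (measure_mono ?_).trans_eq (hρ t 0 (fun _ => (n : ℝ)) fun _ => n.cast_nonneg)
      intro x hx j hj _
      obtain rfl : j = 0 := by omega
      rw [Nat.cast_zero, add_zero]
      refine le_trans hx ?_
      rw [← EReal.coe_zero, EReal.coe_le_coe_iff]
      positivity
    have hlim : Tendsto (fun n : ℕ => ENNReal.ofReal (Real.exp (-(n : ℝ)))) atTop (𝓝 0) := by
      rw [← ENNReal.ofReal_zero]
      exact ENNReal.tendsto_ofReal (Real.tendsto_exp_neg_atTop_nhds_zero.comp
        tendsto_natCast_atTop_atTop)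
    exact le_antisymm (ge_of_tendsto' hlim hle) zero_le
  refine ext_of_generate_finite _ generateFrom_piiUnionInter_lowerHalfSpaces
    (isPiSystem_piiUnionInter _ isPiSystem_lowerHalfSpaces _) ?_ (by simp)
  rintro _ ⟨I, -, f, hf, rfl⟩
  have hf' : ∀ t, ∃ c : EReal, t ∈ I → {x : ℤ → EReal | x t ≤ c} = f t := by
    intro t
    by_cases ht : t ∈ I
    · obtain ⟨c, hc⟩ := hf t ht
      exact ⟨c, fun _ => hc⟩
    · exact ⟨0, fun h => absurd h ht⟩
  choose c hc using hf'
  have he : ⋂ t ∈ I, f t = ⋂ t ∈ I, {x : ℤ → EReal | x t ≤ c t} :=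
    Set.iInter₂_congr fun t ht => (hc t ht).symm
  rw [he]
  by_cases hpos : ∀ t ∈ I, 0 < c t
  · obtain ⟨s, k, w, hw, heq⟩ := exists_window_eq I hpos
    rw [heq, hμ s k w hw, hν s k w hw]
  · push Not at hpos
    obtain ⟨t, ht, hct⟩ := hpos
    have hsub : ⋂ t ∈ I, {x : ℤ → EReal | x t ≤ c t} ⊆ {x | x t ≤ 0} := fun x hx =>
      le_trans (Set.mem_iInter₂.1 hx t ht) hct
    rw [measure_mono_null hsub (hzero μ hμ t), measure_mono_null hsub (hzero ν hν t)]

/-! ### Spectral processes in the cone `D_a` -/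

lemma measurableSet_coneD (a : ℝ) : MeasurableSet (coneD a) := by
  have hn : MeasurableSet {f : ℤ → ℝ | ∀ t, 0 ≤ f t} := by
    rw [Set.ofPred_forall]
    exact MeasurableSet.iInter fun t => measurableSet_le measurable_const (measurable_pi_apply t)
  by_cases ha1 : a = 1
  · have h : coneD a = {f | ∀ t, 0 ≤ f t} ∩ ⋂ t, {f | f t = f 0} := by
      ext f
      simp [coneD, ha1]
    rw [h]
    exact hn.inter (MeasurableSet.iInter fun t =>
      measurableSet_eq_fun (measurable_pi_apply t) (measurable_pi_apply 0))
  by_cases ha0 : a = 0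
  · have h : coneD a = {f | ∀ t, 0 ≤ f t} ∩
        ⋃ t₀, ⋂ t, {f | f t = if t = t₀ then f t₀ else 0} := by
      ext f
      simp [coneD, ha0]
    rw [h]
    refine hn.inter (MeasurableSet.iUnion fun t₀ => MeasurableSet.iInter fun t => ?_)
    refine measurableSet_eq_fun (measurable_pi_apply t) ?_
    split_ifs
    · exact measurable_pi_apply t₀
    · exact measurable_const
  · have h : coneD a = {f | ∀ t, 0 ≤ f t} ∩
        ⋃ t₀, ⋂ t, {f | f t = if t₀ ≤ t then f t₀ * a ^ (t - t₀) else 0} := by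
      ext f
      simp [coneD, ha1, ha0]
    rw [h]
    refine hn.inter (MeasurableSet.iUnion fun t₀ => MeasurableSet.iInter fun t => ?_)
    refine measurableSet_eq_fun (measurable_pi_apply t) ?_
    split_ifs
    · exact (measurable_pi_apply t₀).mul_const _
    · exact measurable_const

/-- On the cone `D_a`, a step of the function is either a multiplication by `a` or the jump at the
starting time. -/
lemma eq_mul_or_eq_zero_of_mem_coneD {a : ℝ} {f : ℤ → ℝ} (hf : f ∈ coneD a) (t : ℤ) :
    f (t + 1) = a * f t ∨ ∀ r ≤ t, f r = 0 := by
  obtain ⟨-, hf⟩ := hf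
  split_ifs at hf with h1 h0
  · left
    rw [hf (t + 1), hf t, h1, one_mul]
  · obtain ⟨t₀, ht₀⟩ := hf
    rcases eq_or_ne (t + 1) t₀ with h | h
    · right
      intro r hr
      rw [ht₀ r, if_neg (by omega)]
    · left
      rw [ht₀ (t + 1), if_neg h, h0, zero_mul]
  · obtain ⟨t₀, ht₀⟩ := hf
    rcases le_or_gt t₀ t with h | h
    · left
      rw [ht₀ (t + 1), ht₀ t, if_pos h, if_pos (by omega), show t + 1 - t₀ = t - t₀ + 1 by ring,
        zpow_add_one₀ h0]
      ring
    · right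
      intro r hr
      rw [ht₀ r, if_neg (by omega)]

lemma windowMax_update_max {a : ℝ} {s : ℤ} {k : ℕ} {w : ℕ → ℝ} {f : ℤ → ℝ}
    (hf : 0 ≤ f (s + k)) :
    windowMax s k (Function.update w k (max (w k) (a * w (k + 1)))) f =
      max (windowMax s k w f) (a * w (k + 1) * f (s + k)) := by
  refine eq_of_forall_ge_iff fun c => ?_
  rw [max_le_iff, windowMax_le_iff, windowMax_le_iff]
  constructor
  · intro h
    have hk := h k le_rfl
    rw [Function.update_self, max_mul_of_nonneg _ _ hf, max_le_iff] at hk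
    refine ⟨fun j hj => ?_, hk.2⟩
    rcases eq_or_ne j k with rfl | hjk
    · exact hk.1
    · simpa [hjk] using h j hj
  · rintro ⟨h, h'⟩ j hj
    rcases eq_or_ne j k with rfl | hjk
    · rw [Function.update_self, max_mul_of_nonneg _ _ hf]
      exact max_le (h j hj) h'
    · simpa [hjk] using h j hj

/-- On the cone `D_a`, the window maxima obey the recursion defining `arExponent`. -/
lemma windowMax_succ_of_mem_coneD {a : ℝ} {f : ℤ → ℝ} (hf : f ∈ coneD a) (s : ℤ) (k : ℕ)
    {w : ℕ → ℝ} (hw : ∀ j, 0 ≤ w j) :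
    windowMax s (k + 1) w f =
      windowMax s k (Function.update w k (max (w k) (a * w (k + 1)))) f +
        w (k + 1) * (f (s + k + 1) - a * f (s + k)) := by
  rw [windowMax_succ, windowMax_update_max (hf.1 _)]
  rcases eq_mul_or_eq_zero_of_mem_coneD hf (s + k) with h | h
  · rw [h, sub_self, mul_zero, add_zero, ← mul_assoc, mul_comm (w (k + 1)) a]
  · have h0 : windowMax s k w f = 0 := by
      refine le_antisymm (windowMax_le_iff.2 fun j hj => ?_) (windowMax_nonneg hw hf.1)
      rw [h _ (by omega), mul_zero]
    rw [h0, h _ le_rfl, max_eq_right (mul_nonneg (hw _) (hf.1 _))]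
    simp

/-- If the spectral process lies in the cone `D_a`, then the max-stable process has the
finite-dimensional distributions of the max-AR(1) process. -/
lemma integral_windowMax_of_mem_coneD {Ω' : Type*} [MeasurableSpace Ω'] {Q : Measure Ω'}
    {Y : Ω' → ℤ → ℝ} (hi : ∀ t, Integrable (fun ω => Y ω t) Q) (h1 : ∀ t, ∫ ω, Y ω t ∂Q = 1)
    {a : ℝ} (hY : ∀ᵐ ω ∂Q, Y ω ∈ coneD a) (s : ℤ) (k : ℕ) {w : ℕ → ℝ} (hw : ∀ j, 0 ≤ w j) :
    ∫ ω, windowMax s k w (Y ω) ∂Q = arExponent a k w := by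
  induction k generalizing w with
  | zero => simp [windowMax_zero, integral_const_mul, h1, arExponent]
  | succ k ih =>
    have hsub : Integrable (fun ω => w (k + 1) * (Y ω (s + k + 1) - a * Y ω (s + k))) Q :=
      ((hi _).sub ((hi _).const_mul a)).const_mul _
    rw [integral_congr_ae (hY.mono fun ω hω => windowMax_succ_of_mem_coneD hω s k hw),
      integral_add (integrable_windowMax hi s k _) hsub, ih (update_max_nonneg a hw k),
      integral_const_mul, integral_sub (hi _) ((hi _).const_mul a), integral_const_mul, h1, h1,
      arExponent]
    ring

/-! ### From the finite-dimensional distributions to the cone `D_a` -/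

/-- If `a * f t ≤ f (t + 1)` with `a > 0`, a zero of `f ≥ 0` forces zeros at all earlier times. -/
lemma eq_zero_of_mul_le_succ {a : ℝ} {f : ℤ → ℝ} (h0 : ∀ t, 0 ≤ f t)
    (hle : ∀ t, a * f t ≤ f (t + 1)) (ha : 0 < a) {s : ℤ} (hs : f s = 0) :
    ∀ t ≤ s, f t = 0 := by
  intro t ht
  induction t, ht using Int.leInductionDown with
  | base => exact hs
  | pred n _ ih =>
    have h := hle (n - 1)
    rw [sub_add_cancel, ih] at h
    exact le_antisymm (nonpos_of_mul_nonpos_right h ha) (h0 (n - 1))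

/-- A pathwise criterion for membership in `D_a`, `0 < a < 1`: once positive, the function is
multiplied by `a` at each step, and the limit condition excludes that it is positive on all
of `ℤ`. -/
lemma mem_coneD_of_step {a : ℝ} (ha₀ : 0 < a) (ha₁ : a < 1) {f : ℤ → ℝ} (h0 : ∀ t, 0 ≤ f t)
    (hle : ∀ t, a * f t ≤ f (t + 1)) (hstep : ∀ t, f (t + 1) = a * f t ∨ f t = 0)
    (hlim : Tendsto (fun k : ℕ => a ^ k * f (-k)) atTop (𝓝 0)) : f ∈ coneD a := by
  refine ⟨h0, ?_⟩
  rw [if_neg ha₁.ne, if_neg ha₀.ne']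
  have hgeo : ∀ s : ℤ, (∀ t ≥ s, f t ≠ 0) → ∀ t, s ≤ t → f t = f s * a ^ (t - s) := by
    intro s hs t ht
    induction t, ht using Int.leInduction with
    | base => simp
    | succ n hn ih =>
      rw [(hstep n).resolve_right (hs n hn), ih, show n + 1 - s = n - s + 1 by ring,
        zpow_add_one₀ ha₀.ne']
      ring
  by_cases hall : ∃ s, f s = 0
  · obtain ⟨s, hs⟩ := hall
    by_cases hex : ∃ t, f t ≠ 0
    · obtain ⟨t₀, ht₀, hmin⟩ := Int.exists_least_of_bdd (P := fun t => f t ≠ 0)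
        ⟨s, fun t ht => by
          by_contra! h
          exact ht (eq_zero_of_mul_le_succ h0 hle ha₀ hs t h.le)⟩ hex
      have hpos : ∀ t ≥ t₀, f t ≠ 0 := fun t ht h =>
        ht₀ (eq_zero_of_mul_le_succ h0 hle ha₀ h t₀ ht)
      refine ⟨t₀, fun t => ?_⟩
      split_ifs with h
      · exact hgeo t₀ hpos t h
      · by_contra h'
        exact h (hmin t h')
    · push Not at hex
      exact ⟨0, fun t => by simp [hex]⟩
  · -- A function without zeros would be `c * a ^ t` on all of `ℤ`, so that `a ^ k * f (-k)` would
    -- not tend to zero.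
    exfalso
    push Not at hall
    have hconst : ∀ k : ℕ, a ^ k * f (-k) = f 0 := by
      intro k
      rw [hgeo (-k) (fun t _ => hall t) 0 (by omega)]
      simp [mul_comm]
    simp only [hconst] at hlim
    exact hall 0 (tendsto_nhds_unique tendsto_const_nhds hlim)

/-- The special case of weights `x` and `1` at two consecutive times. -/
lemma integral_max_succ {Ω' : Type*} [MeasurableSpace Ω'] {Q : Measure Ω'} {Y : Ω' → ℤ → ℝ}
    {a : ℝ} (hfdd : ∀ s k (w : ℕ → ℝ), (∀ j, 0 ≤ w j) →
      ∫ ω, windowMax s k w (Y ω) ∂Q = arExponent a k w) (s : ℤ) {x : ℝ} (hx : 0 ≤ x) :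
    ∫ ω, max (x * Y ω s) (Y ω (s + 1)) ∂Q = max x a + (1 - a) := by
  have h := hfdd s 1 (fun j => if j = 0 then x else 1) fun j => by
    split_ifs
    · exact hx
    · exact zero_le_one
  simpa [windowMax_succ, windowMax_zero, arExponent] using h

/-- If the window maxima of the spectral process have the means prescribed by the max-AR(1)
process, then the spectral process lies in the cone `D_a`. Each path property is read off from a
pointwise inequality between two variables with equal means. -/
lemma ae_mem_coneD_of_integral_windowMax {Ω' : Type*} [MeasurableSpace Ω'] {Q : Measure Ω'}
    {Y : Ω' → ℤ → ℝ} (h0 : ∀ᵐ ω ∂Q, ∀ t, 0 ≤ Y ω t)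
    (hi : ∀ t, Integrable (fun ω => Y ω t) Q) (h1 : ∀ t, ∫ ω, Y ω t ∂Q = 1)
    {a : ℝ} (ha₀ : 0 ≤ a) (ha₁ : a ≤ 1) (hfdd : ∀ s k (w : ℕ → ℝ), (∀ j, 0 ≤ w j) →
      ∫ ω, windowMax s k w (Y ω) ∂Q = arExponent a k w) :
    ∀ᵐ ω ∂Q, Y ω ∈ coneD a := by
  have hmax : ∀ s x, Integrable (fun ω => max (x * Y ω s) (Y ω (s + 1))) Q := fun s x =>
    ((hi s).const_mul x).sup (hi (s + 1))
  -- Weights `(a, 1)`: the mean of `max (a Y(s), Y(s+1))` is that of `Y(s+1)`.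
  have hle : ∀ᵐ ω ∂Q, ∀ s, a * Y ω s ≤ Y ω (s + 1) := by
    refine ae_all_iff.2 fun s => ?_
    have he := (integral_eq_iff_of_ae_le (hi (s + 1)) (hmax s a)
      (ae_of_all _ fun ω => le_max_right _ _)).1 (by
        rw [integral_max_succ hfdd s ha₀, h1]
        simp)
    filter_upwards [he] with ω hω
    exact (le_max_left _ _).trans_eq hω.symm
  rcases ha₁.eq_or_lt with rfl | ha₁
  · have heq : ∀ᵐ ω ∂Q, ∀ s, Y ω s = Y ω (s + 1) := by
      refine ae_all_iff.2 fun s => ?_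
      refine (integral_eq_iff_of_ae_le (hi s) (hi (s + 1)) ?_).1 (by rw [h1, h1])
      filter_upwards [hle] with ω hω
      simpa using hω s
    filter_upwards [h0, heq] with ω hω he
    refine ⟨hω, ?_⟩
    rw [if_pos rfl]
    intro t
    induction t using Int.induction_on with
    | zero => rfl
    | succ n ih => rw [← he, ih]
    | pred n ih =>
      rw [he, sub_add_cancel, ih]
  rcases ha₀.eq_or_lt with rfl | ha₀
  · -- Unit weights: the maximum over a window has the mean of the sum over the window.
    have hone : ∀ k, arExponent 0 k (fun _ => 1) = k + 1 := by
      intro k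
      induction k with
      | zero => simp [arExponent]
      | succ k ih =>
        rw [arExponent]
        simp [ih]
    have hsum : ∀ᵐ ω ∂Q, ∀ (s : ℤ) (k : ℕ), windowMax s k (fun _ => 1) (Y ω) =
        ∑ j ∈ Finset.range (k + 1), Y ω (s + j) := by
      refine ae_all_iff.2 fun s => ae_all_iff.2 fun k => ?_
      have hi' : ∀ j : ℕ, Integrable (fun ω => Y ω (s + j)) Q := fun j => hi (s + j)
      refine (integral_eq_iff_of_ae_le (integrable_windowMax hi s k _)
        (integrable_finsetSum _ fun j _ => hi' j) ?_).1 ?_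
      · filter_upwards [h0] with ω hω
        refine windowMax_le_iff.2 fun j hj => ?_
        rw [one_mul]
        exact Finset.single_le_sum (f := fun j : ℕ => Y ω (s + j)) (fun j _ => hω _)
          (Finset.mem_range.2 (by omega))
      · rw [hfdd s k _ fun _ => zero_le_one, integral_finsetSum _ fun j _ => hi' j, hone]
        simp [h1]
    filter_upwards [h0, hsum] with ω hω hs
    refine ⟨hω, ?_⟩
    rw [if_neg zero_ne_one, if_pos rfl]
    have hpair : ∀ s t, s < t → Y ω s = 0 ∨ Y ω t = 0 := by
      intro s t hst
      obtain ⟨k, rfl⟩ : ∃ k : ℕ, t = s + k := ⟨(t - s).toNat, by omega⟩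
      have hk : k ≠ 0 := by omega
      obtain ⟨i, hik, hi⟩ := exists_partialSups_eq (fun j : ℕ => (1 : ℝ) * Y ω (s + j)) k
      have h2 := hs s k
      rw [windowMax, hi, one_mul] at h2
      have hsub : ∀ j ≤ k, j ≠ i → Y ω (s + j) = 0 := by
        intro j hj hji
        have h3 : Y ω (s + j) + Y ω (s + i) ≤ ∑ j ∈ Finset.range (k + 1), Y ω (s + j) := by
          rw [← Finset.sum_pair (f := fun j : ℕ => Y ω (s + j)) hji]
          refine Finset.sum_le_sum_of_subset_of_nonneg ?_ fun j _ _ => hω _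
          intro l hl
          simp only [Finset.mem_insert, Finset.mem_singleton] at hl
          rw [Finset.mem_range]
          omega
        linarith [hω (s + j)]
      by_cases h : i = 0
      · exact Or.inr (hsub k le_rfl (by omega))
      · left
        simpa using hsub 0 (by omega) (by omega)
    by_cases hex : ∃ t₀, Y ω t₀ ≠ 0
    · obtain ⟨t₀, ht₀⟩ := hex
      refine ⟨t₀, fun t => ?_⟩
      split_ifs with h
      · rw [h]
      · rcases lt_or_gt_of_ne h with h | h
        · exact (hpair t t₀ h).resolve_right ht₀
        · exact (hpair t₀ t h).resolve_left ht₀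
    · push Not at hex
      exact ⟨0, fun t => by simp [hex]⟩
  · -- Weights `(a + 1, 1)`: the mean of `max ((a + 1) Y(s), Y(s+1))` is that of `Y(s) + Y(s+1)`.
    have hstep : ∀ᵐ ω ∂Q, ∀ s, Y ω (s + 1) = a * Y ω s ∨ Y ω s = 0 := by
      refine ae_all_iff.2 fun s => ?_
      have he := (integral_eq_iff_of_ae_le (hmax s (a + 1)) ((hi s).add (hi (s + 1))) (by
        filter_upwards [h0, hle] with ω hω hl
        rw [Pi.add_apply]
        have := hl s
        exact max_le (by linarith) (by linarith [hω s]))).1 (by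
          rw [integral_max_succ hfdd s (by linarith), integral_add' (hi s) (hi (s + 1)), h1, h1,
            max_eq_left (by linarith)]
          ring)
      filter_upwards [he] with ω hω
      rw [Pi.add_apply] at hω
      rcases max_choice ((a + 1) * Y ω s) (Y ω (s + 1)) with h | h
      · left
        linarith
      · right
        linarith
    -- `a ^ k * Y(-k)` has the summable means `a ^ k`.
    have hlim : ∀ᵐ ω ∂Q, Tendsto (fun k : ℕ => a ^ k * Y ω (-k)) atTop (𝓝 0) := by
      have hint : ∀ k : ℕ, ∫⁻ ω, ENNReal.ofReal (a ^ k * Y ω (-k)) ∂Q =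
          ENNReal.ofReal (a ^ k) := by
        intro k
        rw [← ofReal_integral_eq_lintegral_ofReal ((hi _).const_mul _)
          (h0.mono fun ω hω => mul_nonneg (by positivity) (hω _)), integral_const_mul, h1, mul_one]
      have hm : ∀ k : ℕ, AEMeasurable (fun ω => ENNReal.ofReal (a ^ k * Y ω (-k))) Q := fun k =>
        ((hi _).aemeasurable.const_mul _).ennreal_ofReal
      have hfin : ∫⁻ ω, ∑' k : ℕ, ENNReal.ofReal (a ^ k * Y ω (-k)) ∂Q ≠ ∞ := by
        rw [lintegral_tsum hm]
        simp_rw [hint]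
        rw [← ENNReal.ofReal_tsum_of_nonneg (fun k => by positivity)
          (summable_geometric_of_lt_one ha₀.le ha₁)]
        exact ENNReal.ofReal_ne_top
      filter_upwards [h0, ae_lt_top' (AEMeasurable.tsum hm) hfin] with ω hω hs
      have ht := (ENNReal.tendsto_toReal ENNReal.zero_ne_top).comp
        (ENNReal.tendsto_atTop_zero_of_tsum_ne_top hs.ne)
      refine ht.congr fun k => ?_
      exact ENNReal.toReal_ofReal (mul_nonneg (by positivity) (hω _))
    filter_upwards [h0, hle, hstep, hlim] with ω hω hl hs ht
    exact mem_coneD_of_step ha₀ ha₁ hω hl hs ht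

end MaxStable

theorem proposition3p2 {Ω Ω' S T : Type*} [MeasurableSpace Ω] [MeasurableSpace Ω']
    [MeasurableSpace S] [MeasurableSpace T]
    (P : Measure Ω) [IsProbabilityMeasure P] (Q : Measure Ω') [IsProbabilityMeasure Q]
    (R : Measure S) [IsProbabilityMeasure R] (P' : Measure T) [IsProbabilityMeasure P']
    (η : Ω → ℤ → ℝ) (hη : MaxStable.IsSimpleMaxStable η P) (hstat : MaxStable.IsStationary η P)
    (Y : Ω' → ℤ → ℝ) (U : ℕ → S → ℝ) (Y' : ℕ → S → ℤ → ℝ)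
    (hY : MaxStable.IsDeHaanRepresentation η P Y Q U Y' R)
    (F : ℤ → T → ℝ) (hF_indep : iIndepFun F P')
    (hF_law : ∀ n, MaxStable.HasFrechetLaw (F n) P')
    (a : ℝ) (ha₀ : 0 ≤ a) (ha₁ : a ≤ 1) :
    IdentDistrib (fun (ω : Ω) (t : ℤ) => ((η ω t : ℝ) : EReal)) (MaxStable.maxAR a F) P P' ↔
      Q {ω | Y ω ∈ MaxStable.coneD a} = 1 := by
  have hcone : Q {ω | Y ω ∈ MaxStable.coneD a} = 1 ↔ ∀ᵐ ω ∂Q, Y ω ∈ MaxStable.coneD a :=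
    (mem_ae_iff_prob_eq_one (hY.measurable (MaxStable.measurableSet_coneD a))).symm
  have hη_meas := hY.representation.aemeasurable_fst
  have hX_meas := MaxStable.aemeasurable_maxAR (fun n => (hF_law n).1) a
  rw [hcone]
  constructor
  · intro h
    refine MaxStable.ae_mem_coneD_of_integral_windowMax hY.nonneg hY.integrable
      hY.integral_eq_one ha₀ ha₁ fun s k w hw => ?_
    have e1 := hY.measure_window s k hw
    have e2 := MaxStable.measure_maxAR_window hF_indep hF_law ha₀ ha₁ s k hw
    have e3 := h.measure_mem_eq (MaxStable.measurableSet_window s k w)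
    have e4 := (e1.symm.trans e3).trans e2
    rw [ENNReal.ofReal_eq_ofReal_iff (Real.exp_pos _).le (Real.exp_pos _).le, Real.exp_eq_exp,
      neg_inj] at e4
    exact e4
  · intro h
    refine ⟨hη_meas, hX_meas, ?_⟩
    have := Measure.isProbabilityMeasure_map hη_meas
    have := Measure.isProbabilityMeasure_map hX_meas
    refine MaxStable.ext_of_window (a := a) (fun s k w hw => ?_) fun s k w hw => ?_
    · rw [Measure.map_apply_of_aemeasurable hη_meas (MaxStable.measurableSet_window s k w),
        ← MaxStable.integral_windowMax_of_mem_coneD hY.integrable hY.integral_eq_one h s k hw]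
      exact hY.measure_window s k hw
    · rw [Measure.map_apply_of_aemeasurable hX_meas (MaxStable.measurableSet_window s k w)]
      exact MaxStable.measure_maxAR_window hF_indep hF_law ha₀ ha₁ s k hw
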